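/- Let $u,v\in\mathbb R^2$ be unit vectors with $\langle u,v\rangle=\tfrac12$ and let $c\in\mathbb R^2$. Consider the regular hexagon of side length $1$ with centre $c$ and vertices $c\pm u$, $c\pm v$, $c\pm(v-u)$, and the congruent hexagon with centre $c+u+v$, which shares with it the side from $c+u$ to $c+v$. Let $D$ be the unit rhombus (side length $1$, acute angle $\pi/3$) with vertices $c,\ c+u,\ c+v,\ c+v-u$, contained in the first hexagon, and let $E=D+(u+v)$ be the corresponding rhombus of the second hexagon. Let $X$ and $Y$ be independent random points, uniformly distributed in $D$ and in $E$ respectively. Then the Euclidean distance $|X-Y|$ has a probability density function with respect to Lebesgue measure, and it is given by the nonnegative function $f_{D_3}$, supported in $[\tfrac{\sqrt3}{2},3]$, with $$f_{D_3}(d)=2d\begin{cases} -\frac{2d^2}{3\sqrt3}\arcsin\frac{\sqrt3}{2d}+\frac{\pi}{3\sqrt3}d^2-\frac{\sqrt{4d^2-3}}{6}, & \frac{\sqrt3}{2}\le d\le 1,\\[4pt] \frac{d^2+4}{\sqrt3}\arcsin\frac{\sqrt3}{2d}-\left(\frac13+\frac{2\pi}{9\sqrt3}\right)d^2-\frac23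 d+\frac{19}{12}\sqrt{4d^2-3}-\frac{4\pi}{3\sqrt3}-\frac34, & 1\le d\le\sqrt3,\\[4pt] -\left(\frac{d^2}{3\sqrt3}+\frac{10}{\sqrt3}\right)\arcsin\frac{\sqrt3}{d}-\left(\frac{2d^2}{3\sqrt3}+2\sqrt3\right)\arcsin\frac{\sqrt3}{2d}+\left(\frac43+\frac{2\pi}{9\sqrt3}\right)d^2-\frac{13}{6}\sqrt{4d^2-3}-\frac{11}{3}\sqrt{d^2-3}-\frac23 d+\frac{16\pi}{3\sqrt3}+\frac{11}{2}, & \sqrt3\le d\le 2,\\[4pt] \left(\frac{d^2}{3\sqrt3}+2\sqrt3\right)\arcsin\frac{\sqrt3}{d}-\left(\frac{2d^2}{3\sqrt3}+2\sqrt3\right)\arcsin\frac{\sqrt3}{2d}-\frac{13}{6}\sqrt{4d^2-3}+\frac73\sqrt{d^2-3}+2d-\frac12, & 2\le d\le\frac{3\sqrt3}{2},\\[4pt] \left(\frac{2d^2}{3\sqrt3}+4\sqrt3\right)\arcsin\frac{3\sqrt3}{2d}+\left(\frac{d^2}{3\sqrt3}+2\sqrt3\right)\arcsin\frac{\sqrt3}{d}-\left(\frac{2d^2}{3\sqrt3}+2\sqrt3\right)\arcsin\frac{\sqrt3}{2d}-\frac{\pi}{3\sqrt3}d^2-\frac{13}{6}\sqrt{4d^2-3}+\frac73\sqrt{d^2-3}+\frac{11}{6}\sqrt{4d^2-27}+2d-2\sqrt3\,\pi-\frac12,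 & \frac{3\sqrt3}{2}\le d\le\sqrt7,\\[4pt] -\frac{d^2}{3\sqrt3}\arcsin\frac{3\sqrt3}{2d}+\left(\frac{\pi}{9\sqrt3}-\frac13\right)d^2+2d-\frac{\sqrt{4d^2-27}}{4}-\frac94, & \sqrt7\le d\le 3,\\[4pt] 0, & \text{otherwise.} \end{cases}$$ -/

import Mathlib

open MeasureTheory ProbabilityTheory

/-- The closed parallelogram with vertex `p` and side vectors `a`, `b`. -/
def parallelogram (p a b : EuclideanSpace ℝ (Fin 2)) : Set (EuclideanSpace ℝ (Fin 2)) :=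
  {x | ∃ s ∈ Set.Icc (0 : ℝ) 1, ∃ t ∈ Set.Icc (0 : ℝ) 1, x = p + s • a + t • b}

/-!
The two-hexagon configuration. Let `u`, `v` be unit vectors at angle `π / 3`. The unit hexagon with
centre `c` has the vertices `c + u`, `c + v`, `c + (v - u)`, `c - u`, `c - v`, `c + (u - v)` in
cyclic order, and it splits into the three unit rhombuses with vertex `c` whose pairs of side
vectors are `(u, v - u)`, `(v - u, -v)` and `(-v, u)`. The adjacent hexagon across the side from
`c + u` to `c + v` has the centre `c + (u + v)` and is split in the same way.
-/

/-- The rhombus `D`: the one of the first hexagon (centre `c`) that contains the side from `c + u`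
to `c + v` common to the two hexagons. Its vertices are `c`, `c + u`, `c + v`, `c + (v - u)`. -/
def rhombusD (c u v : EuclideanSpace ℝ (Fin 2)) : Set (EuclideanSpace ℝ (Fin 2)) :=
  parallelogram c u (v - u)

/-- The rhombus `E`: the one of the second hexagon (centre `c + (u + v)`) in the same position as
`D` in the first one. -/
def rhombusE (c u v : EuclideanSpace ℝ (Fin 2)) : Set (EuclideanSpace ℝ (Fin 2)) :=
  parallelogram (c + (u + v)) u (v - u)

open Real in
/-- The explicit piecewise density of the distance `|DE|`. -/
noncomputable def densityDE (d : ℝ) : ℝ :=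
  2 * d *
    if √3 / 2 ≤ d ∧ d ≤ 1 then
      -(2 * d ^ 2 / (3 * √3)) * arcsin (√3 / (2 * d)) + π / (3 * √3) * d ^ 2
        - √(4 * d ^ 2 - 3) / 6
    else if 1 ≤ d ∧ d ≤ √3 then
      (d ^ 2 + 4) / √3 * arcsin (√3 / (2 * d)) - (1 / 3 + 2 * π / (9 * √3)) * d ^ 2
        - 2 / 3 * d + 19 / 12 * √(4 * d ^ 2 - 3) - 4 * π / (3 * √3) - 3 / 4
    else if √3 ≤ d ∧ d ≤ 2 then
      -(d ^ 2 / (3 * √3) + 10 / √3) * arcsin (√3 / d)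
        - (2 * d ^ 2 / (3 * √3) + 2 * √3) * arcsin (√3 / (2 * d))
        + (4 / 3 + 2 * π / (9 * √3)) * d ^ 2
        - 13 / 6 * √(4 * d ^ 2 - 3) - 11 / 3 * √(d ^ 2 - 3) - 2 / 3 * d
        + 16 * π / (3 * √3) + 11 / 2
    else if 2 ≤ d ∧ d ≤ 3 * √3 / 2 then
      (d ^ 2 / (3 * √3) + 2 * √3) * arcsin (√3 / d)
        - (2 * d ^ 2 / (3 * √3) + 2 * √3) * arcsin (√3 / (2 * d))
        - 13 / 6 * √(4 * d ^ 2 - 3) + 7 / 3 * √(d ^ 2 - 3) + 2 * d - 1 / 2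
    else if 3 * √3 / 2 ≤ d ∧ d ≤ √7 then
      (2 * d ^ 2 / (3 * √3) + 4 * √3) * arcsin (3 * √3 / (2 * d))
        + (d ^ 2 / (3 * √3) + 2 * √3) * arcsin (√3 / d)
        - (2 * d ^ 2 / (3 * √3) + 2 * √3) * arcsin (√3 / (2 * d))
        - π / (3 * √3) * d ^ 2
        - 13 / 6 * √(4 * d ^ 2 - 3) + 7 / 3 * √(d ^ 2 - 3)
        + 11 / 6 * √(4 * d ^ 2 - 27) + 2 * d - 2 * √3 * π - 1 / 2
    else if √7 ≤ d ∧ d ≤ 3 then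
      -(d ^ 2 / (3 * √3)) * arcsin (3 * √3 / (2 * d)) + (π / (9 * √3) - 1 / 3) * d ^ 2
        + 2 * d - √(4 * d ^ 2 - 27) / 4 - 9 / 4
    else 0

/-! Since `u + v = 2 • u + (v - u)`, in the oblique basis `u`, `v - u` the difference `Y - X` has
coordinates `(p, q) = (2 + s' - s, 1 + t' - t)` with `s, t, s', t'` independent and uniform on `[0,
1]`. So `p - 2` and `q - 1` are independent with the triangular density, and `|X - Y| ^ 2 = p ^ 2 +
q ^ 2 - p * q`, written `Q(p, q)` below.

The circle of radius `r` is parametrized by `p = k sin (θ + π / 3)`, `q = k sin θ` with `k = 2 r /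
√3`, and the area element is `(2 / √3) r dr dθ`. Integrating over circles
(`lintegral_oblique_polar`, `lintegral_triangle_mul_dist`) gives the density `d * (2 / √3) *
triangleInt (2 * d / √3)`; nonnegativity and the support are read off from this form.

To evaluate `triangleInt`, the triangular density is written as a second difference of positive
parts. This leaves nine integrals `circleInt k i j` with `i ∈ {1, 2, 3}`, `j ∈ {0, 1, 2}`, each over
the arc of the circle inside the quadrant `p > i`, `q > j`. The arc is bounded by both sides of the
quadrant if the corner is inside the circle (`circleInt_of_corner`), by the line `p = i` alone if
that line is cut in a segment within `q > j` (`circleInt_of_segment`), or it is empty. The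
breakpoints of the formula are the radii at which one of the nine integrals changes type: the lines
`p = i` are at distance `i * √3 / 2` from the origin, and the corners are at distances `1, √3, 2,
√7, 3`. -/

section

open Real ENNReal

/-! ### Products of two sine waves and the arc where both are large -/

/-- An antiderivative of `θ ↦ (k sin (θ + π / 3) - i) (k sin θ - j)`. -/
noncomputable def sinProdPrimitive (k i j θ : ℝ) : ℝ :=
  k ^ 2 * (θ / 4 - sin (2 * θ + π / 3) / 4) + i * (k * cos θ) + j * (k * cos (θ + π / 3)) + i * j * θ

theorem hasDerivAt_sinProdPrimitive (k i j θ : ℝ) :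
    HasDerivAt (sinProdPrimitive k i j) ((k * sin (θ + π / 3) - i) * (k * sin θ - j)) θ := by
  have h1 : HasDerivAt (fun x : ℝ => sin (2 * x + π / 3)) (cos (2 * θ + π / 3) * 2) θ := by
    have := ((hasDerivAt_id θ).const_mul 2).add_const (π / 3)
    simpa using this.sin
  have h2 : HasDerivAt (fun x : ℝ => cos (x + π / 3)) (-sin (θ + π / 3)) θ := by
    simpa using ((hasDerivAt_id θ).add_const (π / 3)).cos
  have h3 := (((((hasDerivAt_id θ).div_const 4).sub (h1.div_const 4)).const_mul (k ^ 2)).add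
    (((hasDerivAt_cos θ).const_mul k).const_mul i)).add ((h2.const_mul k).const_mul j) |>.add
    ((hasDerivAt_id θ).const_mul (i * j))
  refine h3.congr_deriv ?_
  have e : cos (2 * θ + π / 3) = 1 / 2 - 2 * (sin (θ + π / 3) * sin θ) := by
    rw [show 2 * θ + π / 3 = (θ + π / 3) + θ by ring, cos_add]
    have : cos (θ + π / 3 - θ) = 1 / 2 := by rw [← cos_pi_div_three]; ring_nf
    rw [cos_sub] at this
    linarith
  rw [e]
  ring

theorem integral_sinProd (k i j a b : ℝ) :
    ∫ θ in a..b, (k * sin (θ + π / 3) - i) * (k * sin θ - j) =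
      sinProdPrimitive k i j b - sinProdPrimitive k i j a :=
  intervalIntegral.integral_eq_sub_of_hasDerivAt
    (fun θ _ => hasDerivAt_sinProdPrimitive k i j θ)
    (Continuous.intervalIntegrable (by fun_prop) _ _)

/-- The sine is nonpositive on `[-π, 0]` and `[π, 3π / 2]`, so only the arch over `(0, π)` matters.
No bound `s ≤ 1` is needed: for `s ≥ 1` the value `arcsin s = π / 2` makes the interval empty. -/
theorem lt_sin_iff {s x : ℝ} (hs : 0 ≤ s) (hx : -π < x) (hx' : x ≤ 3 * π / 2) :
    s < sin x ↔ arcsin s < x ∧ x < π - arcsin s := by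
  have h0 := arcsin_nonneg.2 hs
  have h1 := arcsin_le_pi_div_two s
  constructor
  · intro h
    have hx0 : 0 < x := by
      by_contra! hx0
      have := sin_nonpos_of_nonpos_of_neg_pi_le hx0 hx.le
      linarith
    have hxp : x < π := by
      by_contra! hxp
      have := sin_nonneg_of_nonneg_of_le_pi (x := x - π) (by linarith) (by linarith)
      rw [sin_sub_pi] at this
      linarith
    rcases le_total x (π / 2) with h2 | h2
    · have := (arcsin_lt_iff_lt_sin' (x := s) (y := x) ⟨by linarith, h2⟩).2 h
      exact ⟨this, by linarith⟩
    · rw [← sin_pi_sub] at h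
      have := (arcsin_lt_iff_lt_sin' (x := s) (y := π - x) ⟨by linarith, by linarith⟩).2 h
      constructor <;> linarith
  · rintro ⟨h2, h3⟩
    rcases le_total x (π / 2) with h4 | h4
    · exact (arcsin_lt_iff_lt_sin' ⟨by linarith, h4⟩).1 h2
    · rw [← sin_pi_sub]
      exact (arcsin_lt_iff_lt_sin' ⟨by linarith, by linarith⟩).1 (by linarith)

/-- The integral of a product of positive parts of two sine waves, in terms of the interval
`(a, b)` on which both are positive. -/
theorem integral_posPart_sinProd_eq {k i j a b : ℝ} (ha : -π ≤ a) (hab : a ≤ b) (hb : b ≤ π)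
    (h : ∀ θ ∈ Set.Ioo (-π) π,
      (i < k * sin (θ + π / 3) ∧ j < k * sin θ) ↔ (a < θ ∧ θ < b)) :
    ∫ θ in -π..π, max 0 (k * sin (θ + π / 3) - i) * max 0 (k * sin θ - j) =
      sinProdPrimitive k i j b - sinProdPrimitive k i j a := by
  rw [← integral_sinProd, intervalIntegral.integral_of_le (by linarith [pi_pos]),
    intervalIntegral.integral_of_le hab, integral_Ioc_eq_integral_Ioo, integral_Ioc_eq_integral_Ioo]
  have hsub : Set.Ioo a b ⊆ Set.Ioo (-π) π := Set.Ioo_subset_Ioo ha hb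
  rw [setIntegral_eq_of_subset_of_forall_sdiff_eq_zero measurableSet_Ioo hsub
    (f := fun θ => max 0 (k * sin (θ + π / 3) - i) * max 0 (k * sin θ - j))]
  · refine setIntegral_congr_fun measurableSet_Ioo fun θ hθ => ?_
    obtain ⟨h1, h2⟩ := (h θ (hsub hθ)).2 hθ
    rw [max_eq_right (by linarith), max_eq_right (by linarith)]
  · intro θ hθ
    have := mt (h θ hθ.1).1 hθ.2
    rw [not_and_or, not_lt, not_lt] at this
    rcases this with h1 | h1
    · rw [max_eq_left (by linarith), zero_mul]
    · rw [max_eq_left (by linarith : k * sin θ - j ≤ 0), mul_zero]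

theorem posPart_region_iff {k i j : ℝ} (hk : 0 < k) (hi : 0 ≤ i) (hj : 0 ≤ j)
    {θ : ℝ} (hθ : θ ∈ Set.Ioo (-π) π) :
    (i < k * sin (θ + π / 3) ∧ j < k * sin θ) ↔
      (arcsin (i / k) - π / 3 < θ ∧ θ < 2 * π / 3 - arcsin (i / k)) ∧
        (arcsin (j / k) < θ ∧ θ < π - arcsin (j / k)) := by
  obtain ⟨h1, h2⟩ := hθ
  have e (l s : ℝ) : l < k * s ↔ l / k < s := by rw [div_lt_iff₀ hk, mul_comm]
  have := pi_pos
  rw [e, e, lt_sin_iff (by positivity) (by linarith) (by linarith),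
    lt_sin_iff (by positivity) (by linarith) (by linarith)]
  refine and_congr_left' (and_congr ?_ ?_) <;> constructor <;> intro <;> linarith

/-! ### Position of a corner relative to the circle, in terms of angles -/

/-- With `sin x = i / k` and `sin y = j / k`, the left side has the sign of `Q(i, j)` minus the
squared radius; the factorization turns this into conditions on `x + y` and `x - y`. -/
theorem sin_sq_add_sin_sq_sub (x y : ℝ) :
    sin x ^ 2 + sin y ^ 2 - sin x * sin y - 3 / 4 = -((cos (x + y) + 1 / 2) * (cos (x - y) - 1 / 2)) := by
  rw [cos_add, cos_sub]
  have h1 := sin_sq_add_cos_sq x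
  have h2 := sin_sq_add_cos_sq y
  linear_combination cos y ^ 2 * h1 + (1 - sin x ^ 2) * h2


theorem neg_half_lt_cos_iff {x : ℝ} (hx : 0 ≤ x) (hx' : x ≤ π) : -(1 / 2) < cos x ↔ x < 2 * π / 3 := by
  have h : cos (2 * π / 3) = -(1 / 2) := by
    rw [show 2 * π / 3 = π - π / 3 by ring, cos_pi_sub, cos_pi_div_three]
  have := pi_pos
  rw [← h]
  exact strictAntiOn_cos.lt_iff_gt ⟨by linarith, by linarith⟩ ⟨hx, hx'⟩

theorem half_lt_cos_iff {x : ℝ} (hx : |x| ≤ π) : 1 / 2 < cos x ↔ |x| < π / 3 := by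
  have := pi_pos
  rw [← cos_pi_div_three, ← cos_abs x]
  exact strictAntiOn_cos.lt_iff_gt ⟨by linarith, by linarith⟩ ⟨abs_nonneg x, hx⟩

theorem cos_lt_half_iff {x : ℝ} (hx : |x| ≤ π) : cos x < 1 / 2 ↔ π / 3 < |x| := by
  have := pi_pos
  rw [← cos_pi_div_three, ← cos_abs x]
  exact strictAntiOn_cos.lt_iff_gt ⟨abs_nonneg x, hx⟩ ⟨by linarith, by linarith⟩

theorem cos_lt_neg_half_iff {x : ℝ} (hx : 0 ≤ x) (hx' : x ≤ π) :
    cos x < -(1 / 2) ↔ 2 * π / 3 < x := by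
  have h : cos (2 * π / 3) = -(1 / 2) := by
    rw [show 2 * π / 3 = π - π / 3 by ring, cos_pi_sub, cos_pi_div_three]
  have := pi_pos
  rw [← h]
  exact strictAntiOn_cos.lt_iff_gt ⟨hx, hx'⟩ ⟨by linarith, by linarith⟩

/-- The two cosine factors cannot both be negative: `x + y > 2π / 3` and `|x - y| > π / 3` would
force the larger angle above `π / 2`. -/
theorem angle_bounds_of_sin_le {x y : ℝ} (hx : x ∈ Set.Icc 0 (π / 2)) (hy : y ∈ Set.Icc 0 (π / 2))
    (h : sin x ^ 2 + sin y ^ 2 - sin x * sin y ≤ 3 / 4) :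
    |x - y| ≤ π / 3 ∧ x + y ≤ 2 * π / 3 := by
  obtain ⟨hx0, hx1⟩ := hx
  obtain ⟨hy0, hy1⟩ := hy
  have hd : |x - y| ≤ π := abs_le.2 ⟨by linarith, by linarith⟩
  have e := sin_sq_add_sin_sq_sub x y
  have h0 : 0 ≤ (cos (x + y) + 1 / 2) * (cos (x - y) - 1 / 2) := by linarith
  constructor
  · by_contra! hc
    have h1 := (cos_lt_half_iff hd).2 hc
    have h2 : ¬ (-(1 / 2) < cos (x + y)) := fun h2 => by nlinarith
    rw [neg_half_lt_cos_iff (by linarith) (by linarith), not_lt] at h2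
    rcases lt_abs.1 hc with h3 | h3 <;> linarith
  · by_contra! hc
    have h1 := (cos_lt_neg_half_iff (by linarith) (by linarith)).2 hc
    have h2 : ¬ (1 / 2 < cos (x - y)) := fun h2 => by nlinarith
    rw [half_lt_cos_iff hd, not_lt] at h2
    rcases le_abs.1 h2 with h3 | h3 <;> linarith

/-- If `x - y < π / 3`, the sign of the product forces `x + y ≥ 2π / 3`. Then `y > π / 6`, so `sin x
≥ 2 sin y > 1`, which is absurd. -/
theorem angle_diff_ge_of_le_sin {x y : ℝ} (hx : x ∈ Set.Icc 0 (π / 2))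
    (hy : y ∈ Set.Icc 0 (π / 2)) (hxy : 2 * sin y ≤ sin x)
    (h : 3 / 4 ≤ sin x ^ 2 + sin y ^ 2 - sin x * sin y) : π / 3 ≤ x - y := by
  obtain ⟨hx0, hx1⟩ := hx
  obtain ⟨hy0, hy1⟩ := hy
  have := pi_pos
  have hd : |x - y| ≤ π := abs_le.2 ⟨by linarith, by linarith⟩
  have e := sin_sq_add_sin_sq_sub x y
  have h0 : (cos (x + y) + 1 / 2) * (cos (x - y) - 1 / 2) ≤ 0 := by linarith
  have hle : y ≤ x := by
    by_contra! hc
    have h1 := sin_lt_sin_of_lt_of_le_pi_div_two (by linarith) hy1 hc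
    have h2 := sin_nonneg_of_nonneg_of_le_pi hy0 (by linarith)
    linarith
  by_contra! hc
  have h1 := (half_lt_cos_iff hd).2 (abs_lt.2 ⟨by linarith, hc⟩)
  have h2 : ¬ (-(1 / 2) < cos (x + y)) := fun h2 => by nlinarith
  rw [neg_half_lt_cos_iff (by linarith) (by linarith), not_lt] at h2
  have h3 := sin_lt_sin_of_lt_of_le_pi_div_two (x := π / 6) (y := y) (by linarith) hy1 (by linarith)
  rw [sin_pi_div_six] at h3
  linarith [sin_le_one x]

/-! ### Closed forms of the quadrant integrals -/

/-- The integral over the circle of radius `√3 / 2 * k`, in oblique coordinates, of the product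
of the positive parts of the coordinates shifted by `i` and `j`. -/
noncomputable def circleInt (k i j : ℝ) : ℝ :=
  ∫ θ in -π..π, max 0 (k * sin (θ + π / 3) - i) * max 0 (k * sin θ - j)

section values

variable {k i j : ℝ}

theorem mul_cos_arcsin_div (hk : 0 < k) : k * cos (arcsin (i / k)) = √(k ^ 2 - i ^ 2) := by
  rw [cos_arcsin, show k ^ 2 - i ^ 2 = k ^ 2 * (1 - (i / k) ^ 2) by field_simp,
    sqrt_mul (by positivity), sqrt_sq hk.le]

theorem mul_sin_arcsin_div (hk : 0 < k) (hi : 0 ≤ i) (hik : i ≤ k) :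
    k * sin (arcsin (i / k)) = i := by
  rw [sin_arcsin (by linarith [div_nonneg hi hk.le]) ((div_le_one hk).2 hik)]
  field_simp

theorem sinProdPrimitive_right (hk : 0 < k) (hi : 0 ≤ i) (hik : i ≤ k) :
    sinProdPrimitive k i j (2 * π / 3 - arcsin (i / k)) =
      (k ^ 2 / 4 + i * j) * (2 * π / 3 - arcsin (i / k)) +
        (i * √(k ^ 2 - i ^ 2) + √3 / 2 * (k ^ 2 - 2 * i ^ 2)) / 4 +
        i * (√3 / 2 * i - √(k ^ 2 - i ^ 2) / 2) - j * √(k ^ 2 - i ^ 2) := by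
  have hc := mul_cos_arcsin_div (i := i) hk
  have hs := mul_sin_arcsin_div hk hi hik
  set a := arcsin (i / k)
  unfold sinProdPrimitive
  have e1 : sin (2 * (2 * π / 3 - a) + π / 3) = -(sin a * cos a + √3 / 2 * (1 - 2 * sin a ^ 2)) := by
    rw [show 2 * (2 * π / 3 - a) + π / 3 = 2 * π - (π / 3 + 2 * a) by ring, sin_two_pi_sub, sin_add,
      sin_two_mul, cos_two_mul, sin_pi_div_three, cos_pi_div_three, sin_sq]
    ring
  have e2 : cos (2 * π / 3 - a) = -cos a / 2 + √3 / 2 * sin a := by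
    rw [show 2 * π / 3 - a = π - (π / 3 + a) by ring, cos_pi_sub, cos_add, sin_pi_div_three,
      cos_pi_div_three]
    ring
  have e3 : cos (2 * π / 3 - a + π / 3) = -cos a := by
    rw [show 2 * π / 3 - a + π / 3 = π - a by ring, cos_pi_sub]
  rw [e1, e2, e3, ← hc]
  generalize cos a = C at *
  generalize sin a = S at *
  -- Eliminating `i` as `k * S` makes the claim a polynomial identity.
  subst hs
  ring

theorem sinProdPrimitive_left (hk : 0 < k) (hj : 0 ≤ j) (hjk : j ≤ k) :
    sinProdPrimitive k i j (arcsin (j / k)) =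
      (k ^ 2 / 4 + i * j) * arcsin (j / k) -
        (j * √(k ^ 2 - j ^ 2) + √3 / 2 * (k ^ 2 - 2 * j ^ 2)) / 4 +
        i * √(k ^ 2 - j ^ 2) + j * (√(k ^ 2 - j ^ 2) / 2 - √3 / 2 * j) := by
  have hc := mul_cos_arcsin_div (i := j) hk
  have hs := mul_sin_arcsin_div hk hj hjk
  set a := arcsin (j / k)
  unfold sinProdPrimitive
  have e1 : sin (2 * a + π / 3) = sin a * cos a + √3 / 2 * (1 - 2 * sin a ^ 2) := by
    rw [sin_add, sin_two_mul, cos_two_mul, sin_pi_div_three, cos_pi_div_three, sin_sq]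
    ring
  have e2 : cos (a + π / 3) = cos a / 2 - √3 / 2 * sin a := by
    rw [cos_add, sin_pi_div_three, cos_pi_div_three]
    ring
  rw [e1, e2, ← hc]
  generalize cos a = C at *
  generalize sin a = S at *
  subst hs
  ring

theorem sinProdPrimitive_left' (hk : 0 < k) (hi : 0 ≤ i) (hik : i ≤ k) :
    sinProdPrimitive k i j (arcsin (i / k) - π / 3) =
      (k ^ 2 / 4 + i * j) * (arcsin (i / k) - π / 3) -
        (i * √(k ^ 2 - i ^ 2) - √3 / 2 * (k ^ 2 - 2 * i ^ 2)) / 4 +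
        i * (√(k ^ 2 - i ^ 2) / 2 + √3 / 2 * i) + j * √(k ^ 2 - i ^ 2) := by
  have hc := mul_cos_arcsin_div (i := i) hk
  have hs := mul_sin_arcsin_div hk hi hik
  set a := arcsin (i / k)
  unfold sinProdPrimitive
  have e1 : sin (2 * (a - π / 3) + π / 3) = sin a * cos a - √3 / 2 * (1 - 2 * sin a ^ 2) := by
    rw [show 2 * (a - π / 3) + π / 3 = 2 * a - π / 3 by ring, sin_sub, sin_two_mul, cos_two_mul,
      sin_pi_div_three, cos_pi_div_three, sin_sq]
    ring
  have e2 : cos (a - π / 3) = cos a / 2 + √3 / 2 * sin a := by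
    rw [cos_sub, sin_pi_div_three, cos_pi_div_three]
    ring
  rw [e1, e2, sub_add_cancel, ← hc]
  generalize cos a = C at *
  generalize sin a = S at *
  subst hs
  ring

theorem arcsin_div_mem (hk : 0 < k) (hi : 0 ≤ i) : arcsin (i / k) ∈ Set.Icc 0 (π / 2) :=
  ⟨arcsin_nonneg.2 (div_nonneg hi hk.le), arcsin_le_pi_div_two _⟩

theorem sin_quadratic_eq (hk : 0 < k) (hi : 0 ≤ i) (hik : i ≤ k) (hj : 0 ≤ j) (hjk : j ≤ k) :
    sin (arcsin (i / k)) ^ 2 + sin (arcsin (j / k)) ^ 2 -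
      sin (arcsin (i / k)) * sin (arcsin (j / k)) = (i ^ 2 + j ^ 2 - i * j) / k ^ 2 := by
  have e1 : sin (arcsin (i / k)) = i / k := by
    rw [eq_div_iff hk.ne', mul_comm, mul_sin_arcsin_div hk hi hik]
  have e2 : sin (arcsin (j / k)) = j / k := by
    rw [eq_div_iff hk.ne', mul_comm, mul_sin_arcsin_div hk hj hjk]
  rw [e1, e2]
  ring

/-- The case in which the corner `(i, j)` lies inside the circle. -/
theorem circleInt_of_corner (hk : 0 < k) (hi : 0 ≤ i) (hik : i ≤ k) (hj : 0 ≤ j) (hjk : j ≤ k)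
    (h : i ^ 2 + j ^ 2 - i * j ≤ 3 / 4 * k ^ 2) :
    circleInt k i j =
      (k ^ 2 / 4 + i * j) * (2 * π / 3 - arcsin (i / k) - arcsin (j / k)) +
        √3 / 4 * k ^ 2 + √3 / 4 * (i ^ 2 + j ^ 2)
        - (i / 4 + j) * √(k ^ 2 - i ^ 2) - (j / 4 + i) * √(k ^ 2 - j ^ 2) := by
  have hx := arcsin_div_mem hk hi
  have hy := arcsin_div_mem hk hj
  have hs := sin_quadratic_eq hk hi hik hj hjk
  obtain ⟨h1, h2⟩ := angle_bounds_of_sin_le hx hy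
    (by rw [hs, div_le_iff₀ (by positivity)]; exact h)
  obtain ⟨h3, h4⟩ := abs_le.1 h1
  have := pi_pos
  rw [circleInt, integral_posPart_sinProd_eq (a := arcsin (j / k)) (b := 2 * π / 3 - arcsin (i / k)),
    sinProdPrimitive_right hk hi hik, sinProdPrimitive_left hk hj hjk]
  · ring
  · linarith [hy.1]
  · linarith
  · linarith [hx.1]
  · intro θ hθ
    rw [posPart_region_iff hk hi hj hθ]
    constructor
    · rintro ⟨⟨-, h5⟩, h6, -⟩
      exact ⟨h6, h5⟩
    -- The two remaining bounds are implied because the angles of the corner differ by at most `π /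
    -- 3`.
    · rintro ⟨h5, h6⟩
      refine ⟨⟨?_, h6⟩, h5, ?_⟩ <;> linarith

/-- The case in which the circle cuts the half-plane of the first coordinate in a segment lying
in the half-plane of the second one. -/
theorem circleInt_of_segment (hk : 0 < k) (hj : 0 ≤ j) (hij : 2 * j ≤ i) (hik : i ≤ k)
    (h : 3 / 4 * k ^ 2 ≤ i ^ 2 + j ^ 2 - i * j) :
    circleInt k i j =
      (k ^ 2 / 4 + i * j) * (π - 2 * arcsin (i / k)) - (i / 2 + 2 * j) * √(k ^ 2 - i ^ 2) := by
  have hi : 0 ≤ i := by linarith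
  have hjk : j ≤ k := by linarith
  have hx := arcsin_div_mem hk hi
  have hy := arcsin_div_mem hk hj
  have hs := sin_quadratic_eq hk hi hik hj hjk
  -- The hypothesis `2 * j ≤ i` places `(i, i / 2)`, the point of the line `p = i` nearest the
  -- origin, in `q ≥ j`.
  have h1 := angle_diff_ge_of_le_sin hx hy
    (by
      have e1 := mul_sin_arcsin_div hk hi hik
      have e2 := mul_sin_arcsin_div hk hj hjk
      refine le_of_mul_le_mul_left ?_ hk
      linarith)
    (by rw [hs, le_div_iff₀ (by positivity)]; exact h)
  have := pi_pos
  rw [circleInt, integral_posPart_sinProd_eq (a := arcsin (i / k) - π / 3)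
    (b := 2 * π / 3 - arcsin (i / k)), sinProdPrimitive_right hk hi hik,
    sinProdPrimitive_left' hk hi hik]
  · ring
  · linarith [hx.1]
  · linarith [hx.2]
  · linarith [hx.1]
  · intro θ hθ
    rw [posPart_region_iff hk hi hj hθ]
    constructor
    · rintro ⟨h5, -⟩
      exact h5
    · rintro ⟨h5, h6⟩
      refine ⟨⟨h5, h6⟩, ?_, ?_⟩ <;> linarith [hy.1]

theorem sin_add_pi_div_three_quadratic (θ : ℝ) :
    sin (θ + π / 3) ^ 2 + sin θ ^ 2 - sin (θ + π / 3) * sin θ = 3 / 4 := by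
  rw [sin_add, sin_pi_div_three, cos_pi_div_three]
  have h3 : √3 ^ 2 = 3 := sq_sqrt (by norm_num)
  linear_combination 3 / 4 * sin_sq_add_cos_sq θ + cos θ ^ 2 / 4 * h3

/-- The case in which the circle does not meet the quadrant with corner `(i, j)`. -/
theorem circleInt_eq_zero (h : i ≤ 2 * j) (h' : j ≤ 2 * i)
    (hr : 3 / 4 * k ^ 2 ≤ i ^ 2 + j ^ 2 - i * j) : circleInt k i j = 0 := by
  rw [circleInt]
  refine (intervalIntegral.integral_congr fun θ _ => ?_).trans intervalIntegral.integral_zero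
  by_cases h1 : k * sin (θ + π / 3) ≤ i
  · rw [max_eq_left (by linarith), zero_mul]
  by_cases h2 : k * sin θ ≤ j
  · rw [max_eq_left (by linarith : k * sin θ - j ≤ 0), mul_zero]
  exfalso
  push Not at h1 h2
  have e := sin_add_pi_div_three_quadratic θ
  have e' : (k * sin (θ + π / 3)) ^ 2 + (k * sin θ) ^ 2 - (k * sin (θ + π / 3)) * (k * sin θ) =
    3 / 4 * k ^ 2 := by linear_combination k ^ 2 * e
  generalize k * sin (θ + π / 3) = p at *
  generalize k * sin θ = q at *
  -- The corner is the point of the quadrant nearest the origin: `Q(p, q) - Q(i, j) = (p - i)(2i -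
  -- j) + (q - j)(2j - i) + Q(p - i, q - j)`, and the last term is positive.
  nlinarith [mul_nonneg (sub_nonneg.2 h1.le) (sub_nonneg.2 h'),
    mul_nonneg (sub_nonneg.2 h2.le) (sub_nonneg.2 h),
    sq_nonneg (p - i - (q - j)), mul_pos (sub_pos.2 h1) (sub_pos.2 h2)]

theorem circleInt_eq_zero_of_le (hk : 0 ≤ k) (hki : k ≤ i) : circleInt k i j = 0 := by
  rw [circleInt]
  refine (intervalIntegral.integral_congr fun θ _ => ?_).trans intervalIntegral.integral_zero
  rw [max_eq_left, zero_mul]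
  nlinarith [sin_le_one (θ + π / 3)]

end values

/-! ### Reduction of the triangular weight to nine quadrant integrals -/

/-- The triangular density of the difference of two independent uniform variables on `[0, 1]`. -/
noncomputable def triangle (x : ℝ) : ℝ := max 0 (1 - |x|)

/-- A hat function is the second difference of the positive part at its three nodes. -/
theorem triangle_eq (c x : ℝ) :
    triangle (x - c) = max 0 (x - (c - 1)) - 2 * max 0 (x - c) + max 0 (x - (c + 1)) := by
  unfold triangle
  rcases abs_cases (x - c) with ⟨h, h'⟩ | ⟨h, h'⟩ <;> rw [h] <;>
  rcases max_cases 0 (x - (c - 1)) with ⟨h1, h1'⟩ | ⟨h1, h1'⟩ <;> rw [h1] <;>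
  rcases max_cases 0 (x - c) with ⟨h2, h2'⟩ | ⟨h2, h2'⟩ <;> rw [h2] <;>
  rcases max_cases 0 (x - (c + 1)) with ⟨h3, h3'⟩ | ⟨h3, h3'⟩ <;> rw [h3] <;>
  rcases max_cases 0 (1 - (x - c)) with ⟨h4, h4'⟩ | ⟨h4, h4'⟩ <;>
  rcases max_cases 0 (1 - (-(x - c))) with ⟨h5, h5'⟩ | ⟨h5, h5'⟩ <;>
  first | rw [h4]; linarith | rw [h5]; linarith

theorem triangle_nonneg (x : ℝ) : 0 ≤ triangle x := le_max_left _ _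

theorem continuous_triangle : Continuous triangle := by
  unfold triangle
  fun_prop

theorem triangle_eq_zero {x : ℝ} (h : 1 ≤ |x|) : triangle x = 0 := max_eq_left (by linarith)

/-- The integral of the density of `Y - X` in oblique coordinates over the circle of radius
`√3 / 2 * k`. -/
noncomputable def triangleInt (k : ℝ) : ℝ :=
  ∫ θ in -π..π, triangle (k * sin (θ + π / 3) - 2) * triangle (k * sin θ - 1)

theorem triangleInt_eq (k : ℝ) :
    triangleInt k = circleInt k 1 0 - 2 * circleInt k 1 1 + circleInt k 1 2
      - 2 * (circleInt k 2 0 - 2 * circleInt k 2 1 + circleInt k 2 2)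
      + (circleInt k 3 0 - 2 * circleInt k 3 1 + circleInt k 3 2) := by
  have hint (i j : ℝ) : IntervalIntegrable
      (fun θ => max 0 (k * sin (θ + π / 3) - i) * max 0 (k * sin θ - j)) volume (-π) π :=
    Continuous.intervalIntegrable (by fun_prop) _ _
  have h (i : ℝ) : ∫ θ in -π..π, max 0 (k * sin (θ + π / 3) - i) * triangle (k * sin θ - 1) =
      circleInt k i 0 - 2 * circleInt k i 1 + circleInt k i 2 := by
    unfold circleInt
    rw [← intervalIntegral.integral_const_mul, ← intervalIntegral.integral_sub (hint _ _)
      ((hint _ _).const_mul _), ← intervalIntegral.integral_add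
      ((hint _ _).sub ((hint _ _).const_mul _)) (hint _ _)]
    refine intervalIntegral.integral_congr fun θ _ => ?_
    simp only [triangle_eq]
    norm_num
    ring
  have hint' (i : ℝ) : IntervalIntegrable
      (fun θ => max 0 (k * sin (θ + π / 3) - i) * triangle (k * sin θ - 1)) volume (-π) π :=
    Continuous.intervalIntegrable (by have := continuous_triangle; fun_prop) _ _
  rw [← h, ← h, ← h]
  unfold triangleInt
  rw [← intervalIntegral.integral_const_mul, ← intervalIntegral.integral_sub (hint' _)
      ((hint' _).const_mul _), ← intervalIntegral.integral_add
      ((hint' _).sub ((hint' _).const_mul _)) (hint' _)]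
  refine intervalIntegral.integral_congr fun θ _ => ?_
  simp only [triangle_eq 2]
  norm_num
  ring

theorem triangleInt_nonneg (k : ℝ) : 0 ≤ triangleInt k :=
  intervalIntegral.integral_nonneg (by linarith [pi_pos]) fun _ _ =>
    mul_nonneg (triangle_nonneg _) (triangle_nonneg _)

/-- The weight lives on `1 < p < 3`, `0 < q < 2`. There `k ≥ p > 1`, and `Q < 9`, whereas `12 ≤ k ^
2` means `Q ≥ 9` on the circle. -/
theorem triangleInt_eq_zero {k : ℝ} (hk : 0 ≤ k) (h : k ≤ 1 ∨ 12 ≤ k ^ 2) : triangleInt k = 0 := by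
  refine (intervalIntegral.integral_congr fun θ _ => ?_).trans intervalIntegral.integral_zero
  by_cases h1 : 1 ≤ |k * sin (θ + π / 3) - 2|
  · simp [triangle_eq_zero h1]
  by_cases h2 : 1 ≤ |k * sin θ - 1|
  · simp [triangle_eq_zero h2]
  exfalso
  rw [not_le, abs_lt] at h1 h2
  rcases h with h | h
  · nlinarith [sin_le_one (θ + π / 3)]
  · have e' : (k * sin (θ + π / 3)) ^ 2 + (k * sin θ) ^ 2 - (k * sin (θ + π / 3)) * (k * sin θ) =
      3 / 4 * k ^ 2 := by linear_combination k ^ 2 * sin_add_pi_div_three_quadratic θ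
    generalize k * sin (θ + π / 3) = p at *
    generalize k * sin θ = q at *
    have hp : p ^ 2 < 9 := by nlinarith
    nlinarith

/-! ### The explicit density on each range of `d` -/

section

variable {d : ℝ}

theorem arcsin_one_div_eq : arcsin (1 / (2 * d / √3)) = arcsin (√3 / (2 * d)) := by
  congr 1; field_simp

theorem arcsin_two_div_eq : arcsin (2 / (2 * d / √3)) = arcsin (√3 / d) := by
  congr 1; field_simp

theorem arcsin_three_div_eq : arcsin (3 / (2 * d / √3)) = arcsin (3 * √3 / (2 * d)) := by
  congr 1; field_simp

theorem sq_two_mul_div_sqrt_three : (2 * d / √3) ^ 2 = 4 * d ^ 2 / 3 := by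
  rw [div_pow, sq_sqrt (by norm_num)]; ring

theorem sqrt_sub_zero_eq (hd : 0 ≤ d) : √((2 * d / √3) ^ 2 - 0 ^ 2) = 2 * d / √3 := by
  rw [zero_pow two_ne_zero, sub_zero, sqrt_sq (by positivity)]

theorem sqrt_sub_one_eq : √((2 * d / √3) ^ 2 - 1 ^ 2) = √(4 * d ^ 2 - 3) / √3 := by
  rw [sq_two_mul_div_sqrt_three, ← sqrt_div' _ (by norm_num)]; congr 1; ring

theorem sqrt_sub_four_eq : √((2 * d / √3) ^ 2 - 2 ^ 2) = 2 * √(d ^ 2 - 3) / √3 := by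
  rw [sq_two_mul_div_sqrt_three, show 4 * d ^ 2 / 3 - 2 ^ 2 = 2 ^ 2 * ((d ^ 2 - 3) / 3) by ring,
    sqrt_mul (by norm_num), sqrt_sq (by norm_num), sqrt_div' _ (by norm_num), mul_div_assoc]

theorem sqrt_sub_nine_eq : √((2 * d / √3) ^ 2 - 3 ^ 2) = √(4 * d ^ 2 - 27) / √3 := by
  rw [sq_two_mul_div_sqrt_three, ← sqrt_div' _ (by norm_num)]; congr 1; ring

theorem le_two_mul_div_sqrt_three {j : ℝ} (h : j * √3 / 2 ≤ d) : j ≤ 2 * d / √3 := by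
  rw [le_div_iff₀ (by positivity)]; linarith

theorem two_mul_div_sqrt_three_le {j : ℝ} (h : d ≤ j * √3 / 2) : 2 * d / √3 ≤ j := by
  rw [div_le_iff₀ (by positivity)]; linarith

theorem inv_sqrt_three : (√3)⁻¹ = √3 / 3 := by
  rw [inv_eq_one_div, div_eq_div_iff (by positivity) (by norm_num), mul_self_sqrt (by norm_num),
    one_mul]

theorem sqrt_three_sq : √3 ^ 2 = 3 := sq_sqrt (by norm_num)

theorem sqrt_seven_sq : √7 ^ 2 = 7 := sq_sqrt (by norm_num)

/-- Only the line `p = 1` is reached, in a segment between the corners `(1, 0)` and `(1, 1)`, both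
at distance `1`. -/
theorem triangleInt_of_le_one (h1 : √3 / 2 ≤ d) (h2 : d ≤ 1) :
    d * (2 / √3) * triangleInt (2 * d / √3) = 2 * d * (
        -(2 * d ^ 2 / (3 * √3)) * arcsin (√3 / (2 * d)) + π / (3 * √3) * d ^ 2
        - √(4 * d ^ 2 - 3) / 6) := by
  have h3 := sqrt_three_sq
  have p3 : 0 < √3 := by positivity
  have hd : 0 < d := by linarith
  have hK := sq_two_mul_div_sqrt_three (d := d)
  have hK0 : 0 < 2 * d / √3 := by positivity
  have lo : 3 / 4 ≤ d ^ 2 := by nlinarith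
  have hi : d ^ 2 ≤ 1 := by nlinarith
  have k1 : 1 ≤ 2 * d / √3 := le_two_mul_div_sqrt_three (by nlinarith)
  have k2 : 2 * d / √3 ≤ 2 := two_mul_div_sqrt_three_le (by nlinarith)
  have k3 : 2 * d / √3 ≤ 3 := two_mul_div_sqrt_three_le (by nlinarith)
  rw [triangleInt_eq,
    circleInt_of_segment (i := 1) (j := 0) hK0 (by norm_num) (by norm_num) k1 (by rw [hK]; linarith),
    circleInt_eq_zero (i := 1) (j := 1) (by norm_num) (by norm_num) (by rw [hK]; linarith),
    circleInt_eq_zero (i := 1) (j := 2) (by norm_num) (by norm_num) (by rw [hK]; linarith),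
    circleInt_eq_zero_of_le (i := 2) (j := 0) hK0.le k2,
    circleInt_eq_zero_of_le (i := 2) (j := 1) hK0.le k2,
    circleInt_eq_zero_of_le (i := 2) (j := 2) hK0.le k2,
    circleInt_eq_zero_of_le (i := 3) (j := 0) hK0.le k3,
    circleInt_eq_zero_of_le (i := 3) (j := 1) hK0.le k3,
    circleInt_eq_zero_of_le (i := 3) (j := 2) hK0.le k3,
    arcsin_one_div_eq, sqrt_sub_one_eq, hK]
  -- With arcsines and square roots made into free variables and `(√3)⁻¹` replaced by `√3 / 3`, a
  -- polynomial identity modulo `w ^ 2 = 3` remains.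
  clear hK hK0 k1 k2 k3 lo hi h1 h2 hd p3
  generalize arcsin (√3 / (2 * d)) = a1 at *
  generalize √(4 * d ^ 2 - 3) = s1 at *
  simp only [div_eq_mul_inv, mul_inv, inv_sqrt_three]
  generalize √3 = w at *
  grind

/-- The corners `(1, 0)` and `(1, 1)` are now inside; `(1, 2)` and the line `p = 2` are at distance
`√3`. -/
theorem triangleInt_of_one_le (h1 : 1 ≤ d) (h2 : d ≤ √3) :
    d * (2 / √3) * triangleInt (2 * d / √3) = 2 * d * (
        (d ^ 2 + 4) / √3 * arcsin (√3 / (2 * d)) - (1 / 3 + 2 * π / (9 * √3)) * d ^ 2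
        - 2 / 3 * d + 19 / 12 * √(4 * d ^ 2 - 3) - 4 * π / (3 * √3) - 3 / 4) := by
  have h3 := sqrt_three_sq
  have p3 : 0 < √3 := by positivity
  have hd : 0 < d := by linarith
  have hK := sq_two_mul_div_sqrt_three (d := d)
  have hK0 : 0 < 2 * d / √3 := by positivity
  have lo : 1 ≤ d ^ 2 := by nlinarith
  have hi : d ^ 2 ≤ 3 := by nlinarith
  have k1 : 1 ≤ 2 * d / √3 := le_two_mul_div_sqrt_three (by nlinarith)
  have k2 : 2 * d / √3 ≤ 2 := two_mul_div_sqrt_three_le (by nlinarith)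
  have k3 : 2 * d / √3 ≤ 3 := two_mul_div_sqrt_three_le (by nlinarith)
  rw [triangleInt_eq,
    circleInt_of_corner (i := 1) (j := 0) hK0 (by norm_num) k1 (by norm_num) hK0.le
      (by rw [hK]; linarith),
    circleInt_of_corner (i := 1) (j := 1) hK0 (by norm_num) k1 (by norm_num) k1
      (by rw [hK]; linarith),
    circleInt_eq_zero (i := 1) (j := 2) (by norm_num) (by norm_num) (by rw [hK]; linarith),
    circleInt_eq_zero_of_le (i := 2) (j := 0) hK0.le k2,
    circleInt_eq_zero_of_le (i := 2) (j := 1) hK0.le k2,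
    circleInt_eq_zero_of_le (i := 2) (j := 2) hK0.le k2,
    circleInt_eq_zero_of_le (i := 3) (j := 0) hK0.le k3,
    circleInt_eq_zero_of_le (i := 3) (j := 1) hK0.le k3,
    circleInt_eq_zero_of_le (i := 3) (j := 2) hK0.le k3,
    sqrt_sub_zero_eq hd.le, zero_div, arcsin_zero,
    arcsin_one_div_eq, sqrt_sub_one_eq, hK]
  clear hK hK0 k1 k2 k3 lo hi h1 h2 hd p3
  generalize arcsin (√3 / (2 * d)) = a1 at *
  generalize √(4 * d ^ 2 - 3) = s1 at *
  simp only [div_eq_mul_inv, mul_inv, inv_sqrt_three]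
  generalize √3 = w at *
  grind

/-- The corners `(1, 2)` and `(2, 1)` have entered, the latter being the point of `p = 2` nearest
the origin; `(2, 0)` and `(2, 2)` are at distance `2`. -/
theorem triangleInt_of_sqrt_three_le (h1 : √3 ≤ d) (h2 : d ≤ 2) :
    d * (2 / √3) * triangleInt (2 * d / √3) = 2 * d * (
        -(d ^ 2 / (3 * √3) + 10 / √3) * arcsin (√3 / d)
        - (2 * d ^ 2 / (3 * √3) + 2 * √3) * arcsin (√3 / (2 * d))
        + (4 / 3 + 2 * π / (9 * √3)) * d ^ 2
        - 13 / 6 * √(4 * d ^ 2 - 3) - 11 / 3 * √(d ^ 2 - 3) - 2 / 3 * d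
        + 16 * π / (3 * √3) + 11 / 2) := by
  have h3 := sqrt_three_sq
  have p3 : 0 < √3 := by positivity
  have hd : 0 < d := by linarith
  have hK := sq_two_mul_div_sqrt_three (d := d)
  have hK0 : 0 < 2 * d / √3 := by positivity
  have lo : 3 ≤ d ^ 2 := by nlinarith
  have hi : d ^ 2 ≤ 4 := by nlinarith
  have k1 : 1 ≤ 2 * d / √3 := le_two_mul_div_sqrt_three (by nlinarith)
  have k2 : 2 ≤ 2 * d / √3 := le_two_mul_div_sqrt_three (by nlinarith)
  have k3 : 2 * d / √3 ≤ 3 := two_mul_div_sqrt_three_le (by nlinarith)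
  rw [triangleInt_eq,
    circleInt_of_corner (i := 1) (j := 0) hK0 (by norm_num) k1 (by norm_num) hK0.le
      (by rw [hK]; linarith),
    circleInt_of_corner (i := 1) (j := 1) hK0 (by norm_num) k1 (by norm_num) k1
      (by rw [hK]; linarith),
    circleInt_of_corner (i := 1) (j := 2) hK0 (by norm_num) k1 (by norm_num) k2
      (by rw [hK]; linarith),
    circleInt_of_segment (i := 2) (j := 0) hK0 (by norm_num) (by norm_num) k2 (by rw [hK]; linarith),
    circleInt_of_corner (i := 2) (j := 1) hK0 (by norm_num) k2 (by norm_num) k1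
      (by rw [hK]; linarith),
    circleInt_eq_zero (i := 2) (j := 2) (by norm_num) (by norm_num) (by rw [hK]; linarith),
    circleInt_eq_zero_of_le (i := 3) (j := 0) hK0.le k3,
    circleInt_eq_zero_of_le (i := 3) (j := 1) hK0.le k3,
    circleInt_eq_zero_of_le (i := 3) (j := 2) hK0.le k3,
    sqrt_sub_zero_eq hd.le, zero_div, arcsin_zero,
    arcsin_one_div_eq, sqrt_sub_one_eq,
    arcsin_two_div_eq, sqrt_sub_four_eq, hK]
  clear hK hK0 k1 k2 k3 lo hi h1 h2 hd p3
  generalize arcsin (√3 / (2 * d)) = a1 at *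
  generalize √(4 * d ^ 2 - 3) = s1 at *
  generalize arcsin (√3 / d) = a2 at *
  generalize √(d ^ 2 - 3) = s2 at *
  simp only [div_eq_mul_inv, mul_inv, inv_sqrt_three]
  generalize √3 = w at *
  grind

/-- All six corners with `i ≤ 2` are inside, and `p = 3` is not yet reached. -/
theorem triangleInt_of_two_le (h1 : 2 ≤ d) (h2 : d ≤ 3 * √3 / 2) :
    d * (2 / √3) * triangleInt (2 * d / √3) = 2 * d * (
        (d ^ 2 / (3 * √3) + 2 * √3) * arcsin (√3 / d)
        - (2 * d ^ 2 / (3 * √3) + 2 * √3) * arcsin (√3 / (2 * d))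
        - 13 / 6 * √(4 * d ^ 2 - 3) + 7 / 3 * √(d ^ 2 - 3) + 2 * d - 1 / 2) := by
  have h3 := sqrt_three_sq
  have p3 : 0 < √3 := by positivity
  have hd : 0 < d := by linarith
  have hK := sq_two_mul_div_sqrt_three (d := d)
  have hK0 : 0 < 2 * d / √3 := by positivity
  have lo : 4 ≤ d ^ 2 := by nlinarith
  have hi : d ^ 2 ≤ 27 / 4 := by nlinarith
  have k1 : 1 ≤ 2 * d / √3 := le_two_mul_div_sqrt_three (by nlinarith)
  have k2 : 2 ≤ 2 * d / √3 := le_two_mul_div_sqrt_three (by nlinarith)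
  have k3 : 2 * d / √3 ≤ 3 := two_mul_div_sqrt_three_le (by nlinarith)
  rw [triangleInt_eq,
    circleInt_of_corner (i := 1) (j := 0) hK0 (by norm_num) k1 (by norm_num) hK0.le
      (by rw [hK]; linarith),
    circleInt_of_corner (i := 1) (j := 1) hK0 (by norm_num) k1 (by norm_num) k1
      (by rw [hK]; linarith),
    circleInt_of_corner (i := 1) (j := 2) hK0 (by norm_num) k1 (by norm_num) k2
      (by rw [hK]; linarith),
    circleInt_of_corner (i := 2) (j := 0) hK0 (by norm_num) k2 (by norm_num) hK0.le
      (by rw [hK]; linarith),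
    circleInt_of_corner (i := 2) (j := 1) hK0 (by norm_num) k2 (by norm_num) k1
      (by rw [hK]; linarith),
    circleInt_of_corner (i := 2) (j := 2) hK0 (by norm_num) k2 (by norm_num) k2
      (by rw [hK]; linarith),
    circleInt_eq_zero_of_le (i := 3) (j := 0) hK0.le k3,
    circleInt_eq_zero_of_le (i := 3) (j := 1) hK0.le k3,
    circleInt_eq_zero_of_le (i := 3) (j := 2) hK0.le k3,
    sqrt_sub_zero_eq hd.le, zero_div, arcsin_zero,
    arcsin_one_div_eq, sqrt_sub_one_eq,
    arcsin_two_div_eq, sqrt_sub_four_eq, hK]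
  clear hK hK0 k1 k2 k3 lo hi h1 h2 hd p3
  generalize arcsin (√3 / (2 * d)) = a1 at *
  generalize √(4 * d ^ 2 - 3) = s1 at *
  generalize arcsin (√3 / d) = a2 at *
  generalize √(d ^ 2 - 3) = s2 at *
  simp only [div_eq_mul_inv, mul_inv, inv_sqrt_three]
  generalize √3 = w at *
  grind

/-- The line `p = 3` is cut around `(3, 3 / 2)`, between `(3, 1)` and `(3, 2)`, both at distance
`√7`. -/
theorem triangleInt_of_three_mul_sqrt_three_div_two_le (h1 : 3 * √3 / 2 ≤ d) (h2 : d ≤ √7) :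
    d * (2 / √3) * triangleInt (2 * d / √3) = 2 * d * (
        (2 * d ^ 2 / (3 * √3) + 4 * √3) * arcsin (3 * √3 / (2 * d))
        + (d ^ 2 / (3 * √3) + 2 * √3) * arcsin (√3 / d)
        - (2 * d ^ 2 / (3 * √3) + 2 * √3) * arcsin (√3 / (2 * d))
        - π / (3 * √3) * d ^ 2
        - 13 / 6 * √(4 * d ^ 2 - 3) + 7 / 3 * √(d ^ 2 - 3)
        + 11 / 6 * √(4 * d ^ 2 - 27) + 2 * d - 2 * √3 * π - 1 / 2) := by
  have h3 := sqrt_three_sq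
  have h7 := sqrt_seven_sq
  have p7 : 0 < √7 := by positivity
  have p3 : 0 < √3 := by positivity
  have hd : 0 < d := by linarith
  have hK := sq_two_mul_div_sqrt_three (d := d)
  have hK0 : 0 < 2 * d / √3 := by positivity
  have lo : 27 / 4 ≤ d ^ 2 := by nlinarith
  have hi : d ^ 2 ≤ 7 := by nlinarith
  have k1 : 1 ≤ 2 * d / √3 := le_two_mul_div_sqrt_three (by nlinarith)
  have k2 : 2 ≤ 2 * d / √3 := le_two_mul_div_sqrt_three (by nlinarith)
  have k3 : 3 ≤ 2 * d / √3 := le_two_mul_div_sqrt_three (by nlinarith)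
  rw [triangleInt_eq,
    circleInt_of_corner (i := 1) (j := 0) hK0 (by norm_num) k1 (by norm_num) hK0.le
      (by rw [hK]; linarith),
    circleInt_of_corner (i := 1) (j := 1) hK0 (by norm_num) k1 (by norm_num) k1
      (by rw [hK]; linarith),
    circleInt_of_corner (i := 1) (j := 2) hK0 (by norm_num) k1 (by norm_num) k2
      (by rw [hK]; linarith),
    circleInt_of_corner (i := 2) (j := 0) hK0 (by norm_num) k2 (by norm_num) hK0.le
      (by rw [hK]; linarith),
    circleInt_of_corner (i := 2) (j := 1) hK0 (by norm_num) k2 (by norm_num) k1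
      (by rw [hK]; linarith),
    circleInt_of_corner (i := 2) (j := 2) hK0 (by norm_num) k2 (by norm_num) k2
      (by rw [hK]; linarith),
    circleInt_of_segment (i := 3) (j := 0) hK0 (by norm_num) (by norm_num) k3 (by rw [hK]; linarith),
    circleInt_of_segment (i := 3) (j := 1) hK0 (by norm_num) (by norm_num) k3 (by rw [hK]; linarith),
    circleInt_eq_zero (i := 3) (j := 2) (by norm_num) (by norm_num) (by rw [hK]; linarith),
    sqrt_sub_zero_eq hd.le, zero_div, arcsin_zero,
    arcsin_one_div_eq, sqrt_sub_one_eq,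
    arcsin_two_div_eq, sqrt_sub_four_eq,
    arcsin_three_div_eq, sqrt_sub_nine_eq, hK]
  clear hK hK0 k1 k2 k3 lo hi h1 h2 hd p3 p7 h7
  generalize arcsin (√3 / (2 * d)) = a1 at *
  generalize √(4 * d ^ 2 - 3) = s1 at *
  generalize arcsin (√3 / d) = a2 at *
  generalize √(d ^ 2 - 3) = s2 at *
  generalize arcsin (3 * √3 / (2 * d)) = a3 at *
  generalize √(4 * d ^ 2 - 27) = s3 at *
  simp only [div_eq_mul_inv, mul_inv, inv_sqrt_three]
  generalize √3 = w at *
  grind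

/-- Of the nine corners only `(3, 0)`, at distance `3`, is still outside. -/
theorem triangleInt_of_sqrt_seven_le (h1 : √7 ≤ d) (h2 : d ≤ 3) :
    d * (2 / √3) * triangleInt (2 * d / √3) = 2 * d * (
        -(d ^ 2 / (3 * √3)) * arcsin (3 * √3 / (2 * d)) + (π / (9 * √3) - 1 / 3) * d ^ 2
        + 2 * d - √(4 * d ^ 2 - 27) / 4 - 9 / 4) := by
  have h3 := sqrt_three_sq
  have h7 := sqrt_seven_sq
  have p7 : 0 < √7 := by positivity
  have p3 : 0 < √3 := by positivity
  have hd : 0 < d := by linarith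
  have hK := sq_two_mul_div_sqrt_three (d := d)
  have hK0 : 0 < 2 * d / √3 := by positivity
  have lo : 7 ≤ d ^ 2 := by nlinarith
  have hi : d ^ 2 ≤ 9 := by nlinarith
  have k1 : 1 ≤ 2 * d / √3 := le_two_mul_div_sqrt_three (by nlinarith)
  have k2 : 2 ≤ 2 * d / √3 := le_two_mul_div_sqrt_three (by nlinarith)
  have k3 : 3 ≤ 2 * d / √3 := le_two_mul_div_sqrt_three (by nlinarith)
  rw [triangleInt_eq,
    circleInt_of_corner (i := 1) (j := 0) hK0 (by norm_num) k1 (by norm_num) hK0.le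
      (by rw [hK]; linarith),
    circleInt_of_corner (i := 1) (j := 1) hK0 (by norm_num) k1 (by norm_num) k1
      (by rw [hK]; linarith),
    circleInt_of_corner (i := 1) (j := 2) hK0 (by norm_num) k1 (by norm_num) k2
      (by rw [hK]; linarith),
    circleInt_of_corner (i := 2) (j := 0) hK0 (by norm_num) k2 (by norm_num) hK0.le
      (by rw [hK]; linarith),
    circleInt_of_corner (i := 2) (j := 1) hK0 (by norm_num) k2 (by norm_num) k1
      (by rw [hK]; linarith),
    circleInt_of_corner (i := 2) (j := 2) hK0 (by norm_num) k2 (by norm_num) k2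
      (by rw [hK]; linarith),
    circleInt_of_segment (i := 3) (j := 0) hK0 (by norm_num) (by norm_num) k3 (by rw [hK]; linarith),
    circleInt_of_corner (i := 3) (j := 1) hK0 (by norm_num) k3 (by norm_num) k1
      (by rw [hK]; linarith),
    circleInt_of_corner (i := 3) (j := 2) hK0 (by norm_num) k3 (by norm_num) k2
      (by rw [hK]; linarith),
    sqrt_sub_zero_eq hd.le, zero_div, arcsin_zero,
    arcsin_one_div_eq, sqrt_sub_one_eq,
    arcsin_two_div_eq, sqrt_sub_four_eq,
    arcsin_three_div_eq, sqrt_sub_nine_eq, hK]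
  clear hK hK0 k1 k2 k3 lo hi h1 h2 hd p3 p7 h7
  generalize arcsin (√3 / (2 * d)) = a1 at *
  generalize √(4 * d ^ 2 - 3) = s1 at *
  generalize arcsin (√3 / d) = a2 at *
  generalize √(d ^ 2 - 3) = s2 at *
  generalize arcsin (3 * √3 / (2 * d)) = a3 at *
  generalize √(4 * d ^ 2 - 27) = s3 at *
  simp only [div_eq_mul_inv, mul_inv, inv_sqrt_three]
  generalize √3 = w at *
  grind

theorem densityDE_eq_of_nonneg (hd : 0 ≤ d) :
    densityDE d = d * (2 / √3) * triangleInt (2 * d / √3) := by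
  have h3 := sqrt_three_sq
  have h7 := sqrt_seven_sq
  have p3 : 0 < √3 := by positivity
  have p7 : 0 < √7 := by positivity
  unfold densityDE
  split_ifs with hA hB hC hD hE hF
  · exact (triangleInt_of_le_one hA.1 hA.2).symm
  · exact (triangleInt_of_one_le hB.1 hB.2).symm
  · exact (triangleInt_of_sqrt_three_le hC.1 hC.2).symm
  · exact (triangleInt_of_two_le hD.1 hD.2).symm
  · exact (triangleInt_of_three_mul_sqrt_three_div_two_le hE.1 hE.2).symm
  · exact (triangleInt_of_sqrt_seven_le hF.1 hF.2).symm
  · rw [triangleInt_eq_zero (by positivity), mul_zero, mul_zero]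
    rw [sq_two_mul_div_sqrt_three]
    by_contra! hc
    obtain ⟨hc1, hc2⟩ := hc
    have g1 : √3 / 2 < d := by
      rw [lt_div_iff₀ p3] at hc1
      linarith
    have g2 : d < 3 := by nlinarith
    -- Negating the branches in order pushes `d` past each breakpoint in turn, finally past `3`.
    push Not at hA hB hC hD hE hF
    linarith [hF (hE (hD (hC (hB (hA g1.le).le).le).le).le).le]

end

theorem densityDE_eq_zero_of_notMem {d : ℝ} (h : d ∉ Set.Icc (√3 / 2) 3) : densityDE d = 0 := by
  have h3 := sqrt_three_sq
  have p3 : 0 < √3 := by positivity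
  rcases lt_or_ge d 0 with hd | hd
  · unfold densityDE
    have p7 : 0 < √7 := by positivity
    rw [if_neg, if_neg, if_neg, if_neg, if_neg, if_neg, mul_zero]
    all_goals
      rintro ⟨h1, -⟩
      linarith
  · rw [densityDE_eq_of_nonneg hd, triangleInt_eq_zero (by positivity), mul_zero]
    rw [Set.mem_Icc, not_and_or, not_le, not_le] at h
    rw [sq_two_mul_div_sqrt_three]
    rcases h with h | h
    · left
      rw [div_le_one p3]
      linarith
    · right
      nlinarith

theorem densityDE_nonneg (d : ℝ) : 0 ≤ densityDE d := by
  rcases lt_or_ge d 0 with hd | hd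
  · rw [densityDE_eq_zero_of_notMem]
    rintro ⟨h1, -⟩
    have : 0 < √3 := by positivity
    linarith
  · rw [densityDE_eq_of_nonneg hd]
    exact mul_nonneg (by positivity) (triangleInt_nonneg _)

theorem measurable_densityDE : Measurable densityDE := by
  have hI (a b : ℝ) : MeasurableSet {d : ℝ | a ≤ d ∧ d ≤ b} := measurableSet_Icc
  have ha {f : ℝ → ℝ} (hf : Measurable f) : Measurable fun d => arcsin (f d) :=
    continuous_arcsin.measurable.comp hf
  unfold densityDE
  refine Measurable.mul (by fun_prop) ?_
  have m1 : Measurable fun d : ℝ => arcsin (√3 / (2 * d)) := ha (by fun_prop)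
  have m2 : Measurable fun d : ℝ => arcsin (√3 / d) := ha (by fun_prop)
  have m3 : Measurable fun d : ℝ => arcsin (3 * √3 / (2 * d)) := ha (by fun_prop)
  refine Measurable.ite (hI _ _) (by fun_prop) <| Measurable.ite (hI _ _) (by fun_prop) <|
    Measurable.ite (hI _ _) (by fun_prop) <| Measurable.ite (hI _ _) (by fun_prop) <|
    Measurable.ite (hI _ _) (by fun_prop) <| Measurable.ite (hI _ _) (by fun_prop) measurable_const

/-! ### Uniform law on a parallelogram -/

/-- The map `(s, t) ↦ p + s a + t b` parametrizing a parallelogram by the unit square. -/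
noncomputable def parallelogramMap (p a b : EuclideanSpace ℝ (Fin 2)) (x : ℝ × ℝ) :
    EuclideanSpace ℝ (Fin 2) := p + x.1 • a + x.2 • b

theorem continuous_parallelogramMap (p a b : EuclideanSpace ℝ (Fin 2)) :
    Continuous (parallelogramMap p a b) := by
  unfold parallelogramMap
  fun_prop

/-- The uniform distribution on the unit interval. -/
noncomputable def unitMeasure : Measure ℝ := volume.restrict (Set.Icc 0 1)

instance : IsProbabilityMeasure unitMeasure := ⟨by simp [unitMeasure]⟩

theorem parallelogramMap_image (p a b : EuclideanSpace ℝ (Fin 2)) :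
    parallelogramMap p a b '' (Set.Icc 0 1 ×ˢ Set.Icc 0 1) = parallelogram p a b := by
  ext x
  simp only [parallelogramMap, parallelogram, Set.mem_image, Prod.exists, Set.mem_prod]
  constructor
  · rintro ⟨s, t, ⟨hs, ht⟩, rfl⟩
    exact ⟨s, hs, t, ht, rfl⟩
  · rintro ⟨s, hs, t, ht, rfl⟩
    exact ⟨s, t, ⟨hs, ht⟩, rfl⟩

/-- The affine parametrization carries Lebesgue measure to a translation-invariant measure, hence to
a multiple `κ` of the volume. Total mass one identifies `κ`, so no determinant is computed. -/
theorem cond_parallelogram_eq_map {p a b : EuclideanSpace ℝ (Fin 2)}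
    (hab : ∀ s t : ℝ, s • a + t • b = 0 → s = 0 ∧ t = 0) :
    ProbabilityTheory.cond volume (parallelogram p a b) =
      (unitMeasure.prod unitMeasure).map (parallelogramMap p a b) := by
  let T : ℝ × ℝ →ₗ[ℝ] EuclideanSpace ℝ (Fin 2) :=
    (LinearMap.fst ℝ ℝ ℝ).smulRight a + (LinearMap.snd ℝ ℝ ℝ).smulRight b
  have hT : Function.Injective T := by
    rw [← LinearMap.ker_eq_bot, LinearMap.ker_eq_bot']
    intro x hx
    have := hab x.1 x.2 hx
    exact Prod.ext this.1 this.2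
  let e : (ℝ × ℝ) ≃L[ℝ] EuclideanSpace ℝ (Fin 2) :=
    (LinearMap.linearEquivOfInjective T hT (by simp)).toContinuousLinearEquiv
  have hf : parallelogramMap p a b = fun x => p + e x := by
    funext x
    rw [parallelogramMap, add_assoc]
    rfl
  have hemb : MeasurableEmbedding (parallelogramMap p a b) := by
    rw [hf]
    exact (measurableEmbedding_addLeft p).comp e.toHomeomorph.measurableEmbedding
  have : (Measure.map e (volume : Measure (ℝ × ℝ))).IsAddHaarMeasure :=
    e.isAddHaarMeasure_map volume
  have hmap : Measure.map (parallelogramMap p a b) volume = Measure.map e volume := by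
    rw [hf, ← map_add_left_eq_self (Measure.map e volume) p,
      Measure.map_map (by fun_prop) (by fun_prop)]
    rfl
  obtain ⟨κ, hκ⟩ : ∃ κ : NNReal, Measure.map (parallelogramMap p a b) volume =
      κ • (volume : Measure (EuclideanSpace ℝ (Fin 2))) :=
    ⟨_, hmap.trans (Measure.isAddLeftInvariant_eq_smul (Measure.map e volume) volume)⟩
  have hrestr : (unitMeasure.prod unitMeasure).map (parallelogramMap p a b) =
      (κ : ℝ≥0∞) • volume.restrict (parallelogram p a b) := by
    rw [unitMeasure, Measure.prod_restrict, ← Measure.volume_eq_prod, ← parallelogramMap_image]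
    conv_lhs => rw [← Set.preimage_image_eq (Set.Icc 0 1 ×ˢ Set.Icc 0 1) hemb.injective]
    rw [← hemb.restrict_map, hκ, Measure.restrict_smul]
    rfl
  have hone : (κ : ℝ≥0∞) * volume (parallelogram p a b) = 1 := by
    have h1 : (unitMeasure.prod unitMeasure).map (parallelogramMap p a b) Set.univ = 1 := by
      rw [Measure.map_apply (continuous_parallelogramMap p a b).measurable .univ]
      simp
    rw [hrestr] at h1
    simpa using h1
  rw [hrestr, ENNReal.eq_inv_of_mul_eq_one_left hone, ProbabilityTheory.cond]

/-! ### Law of the coordinate differences -/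

theorem volume_Icc_inter_Icc_sub (x : ℝ) :
    volume (Set.Icc (0 : ℝ) 1 ∩ Set.Icc (-x) (1 - x)) = ENNReal.ofReal (triangle x) := by
  rw [Set.Icc_inter_Icc, volume_Icc, triangle]
  rcases abs_cases x with ⟨h, h'⟩ | ⟨h, h'⟩ <;> rw [h]
  · rw [sup_of_le_left (by linarith), inf_of_le_right (by linarith), sub_zero]
    rcases max_cases 0 (1 - x) with ⟨h1, h2⟩ | ⟨h1, h2⟩ <;> rw [h1]
    rw [ENNReal.ofReal_zero, ENNReal.ofReal_of_nonpos h2]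
  · rw [sup_of_le_right (by linarith), inf_of_le_left (by linarith)]
    rcases max_cases 0 (1 - -x) with ⟨h1, h2⟩ | ⟨h1, h2⟩ <;> rw [h1]
    rw [ENNReal.ofReal_zero, ENNReal.ofReal_of_nonpos h2]

/-- Substituting `t = x + s` and swapping the integrals leaves, for each `x`, the length of the set
of `s` in `[0, 1]` with `x + s` in `[0, 1]`. -/
theorem lintegral_unitMeasure_sub {φ : ℝ → ℝ≥0∞} (hφ : Measurable φ) :
    ∫⁻ s, ∫⁻ t, φ (t - s) ∂unitMeasure ∂unitMeasure =
      ∫⁻ x, ENNReal.ofReal (triangle x) * φ x := by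
  have h1 (s : ℝ) : ∫⁻ t, φ (t - s) ∂unitMeasure =
      ∫⁻ x, (Set.Icc (0 : ℝ) 1).indicator 1 (x + s) * φ x := by
    rw [unitMeasure, ← lintegral_indicator measurableSet_Icc,
      ← lintegral_add_right_eq_self (fun t => (Set.Icc (0 : ℝ) 1).indicator _ t) s]
    refine lintegral_congr fun x => ?_
    by_cases hx : x + s ∈ Set.Icc (0 : ℝ) 1
    · simp [Set.indicator_of_mem hx]
    · simp [Set.indicator_of_notMem hx]
  have hind : Measurable ((Set.Icc (0 : ℝ) 1).indicator (1 : ℝ → ℝ≥0∞)) :=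
    measurable_one.indicator measurableSet_Icc
  simp_rw [h1]
  rw [lintegral_lintegral_swap]
  · refine lintegral_congr fun x => ?_
    rw [lintegral_mul_const _ (by fun_prop), ← volume_Icc_inter_Icc_sub]
    congr 1
    rw [unitMeasure, show (fun s : ℝ => (Set.Icc (0 : ℝ) 1).indicator (1 : ℝ → ℝ≥0∞) (x + s)) =
      (Set.Icc (-x) (1 - x)).indicator 1 from ?_, lintegral_indicator_one measurableSet_Icc,
      Measure.restrict_apply measurableSet_Icc, Set.inter_comm]
    funext s
    simp only [Set.indicator, Set.mem_Icc]
    congr 1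
    refine propext ⟨?_, ?_⟩ <;> rintro ⟨h, h'⟩ <;> constructor <;> linarith
  · refine Measurable.aemeasurable ?_
    unfold Function.uncurry
    fun_prop

theorem measurable_triangle : Measurable fun x => ENNReal.ofReal (triangle x) :=
  continuous_triangle.measurable.ennreal_ofReal

theorem lintegral_unitSquare_sub {φ : ℝ → ℝ → ℝ≥0∞} (hφ : Measurable (Function.uncurry φ)) :
    ∫⁻ z, φ (z.2.1 - z.1.1) (z.2.2 - z.1.2)
        ∂(unitMeasure.prod unitMeasure).prod (unitMeasure.prod unitMeasure) =
      ∫⁻ x, ∫⁻ y, ENNReal.ofReal (triangle x) * (ENNReal.ofReal (triangle y) * φ x y) := by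
  have hm {α : Type} [MeasurableSpace α] {f g : α → ℝ} (hf : Measurable f) (hg : Measurable g) :
      Measurable fun a => φ (f a) (g a) := hφ.comp (hf.prodMk hg)
  have hG : Measurable fun x => ∫⁻ y, ENNReal.ofReal (triangle y) * φ x y :=
    Measurable.lintegral_prod_right'
      (f := fun z : ℝ × ℝ => ENNReal.ofReal (triangle z.2) * φ z.1 z.2)
      ((measurable_triangle.comp measurable_snd).mul hφ)
  calc
    _ = ∫⁻ s, ∫⁻ t, ∫⁻ s', ∫⁻ t', φ (s' - s) (t' - t)
          ∂unitMeasure ∂unitMeasure ∂unitMeasure ∂unitMeasure := by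
      rw [lintegral_prod _ (hm (by fun_prop) (by fun_prop)).aemeasurable,
        lintegral_prod]
      · refine lintegral_congr fun s => lintegral_congr fun t => ?_
        rw [lintegral_prod _ (hm (by fun_prop) (by fun_prop)).aemeasurable]
      · exact (Measurable.lintegral_prod_right'
          (f := fun z : (ℝ × ℝ) × (ℝ × ℝ) => φ (z.2.1 - z.1.1) (z.2.2 - z.1.2))
          (hm (by fun_prop) (by fun_prop))).aemeasurable
    _ = ∫⁻ s, ∫⁻ s', ∫⁻ t, ∫⁻ t', φ (s' - s) (t' - t)
          ∂unitMeasure ∂unitMeasure ∂unitMeasure ∂unitMeasure := by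
      refine lintegral_congr fun s => lintegral_lintegral_swap ?_
      exact (Measurable.lintegral_prod_right'
          (f := fun z : (ℝ × ℝ) × ℝ => φ (z.1.2 - s) (z.2 - z.1.1))
          (hm (by fun_prop) (by fun_prop))).aemeasurable
    _ = ∫⁻ s, ∫⁻ s', ∫⁻ y, ENNReal.ofReal (triangle y) * φ (s' - s) y
          ∂volume ∂unitMeasure ∂unitMeasure := by
      refine lintegral_congr fun s => lintegral_congr fun s' => ?_
      exact lintegral_unitMeasure_sub (φ := fun y => φ (s' - s) y) (hm (by fun_prop) (by fun_prop))
    _ = _ := by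
      rw [lintegral_unitMeasure_sub hG]
      refine lintegral_congr fun x => ?_
      rw [lintegral_const_mul]
      exact measurable_triangle.mul (hm (by fun_prop) (by fun_prop))

/-! ### Polar coordinates adapted to the oblique basis -/

theorem lintegral_eq_scale {c : ℝ} (hc : 0 < c) {φ : ℝ → ℝ≥0∞} (hφ : Measurable φ) :
    ∫⁻ x, φ x = ENNReal.ofReal c * ∫⁻ x, φ (c * x) := by
  conv_lhs => rw [← Real.smul_map_volume_mul_left hc.ne']
  rw [lintegral_smul_measure, lintegral_map hφ (by fun_prop), abs_of_pos hc, smul_eq_mul]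

/-- The substitution `p = x + y / √3`, `q = 2 y / √3` turns `Q(p, q)` into `x ^ 2 + y ^ 2`. It is
made as a scaling in `q` and a shear in `p`, before ordinary polar coordinates. -/
theorem lintegral_oblique_polar {g : ℝ → ℝ → ℝ≥0∞} (hg : Measurable (Function.uncurry g)) :
    ∫⁻ p, ∫⁻ q, g p q = ∫⁻ r in Set.Ioi (0 : ℝ), ENNReal.ofReal (r * (2 / √3)) *
      ∫⁻ θ in Set.Ioo (-π) π, g (2 * r / √3 * sin (θ + π / 3)) (2 * r / √3 * sin θ) := by
  have hm {α : Type} [MeasurableSpace α] {f h : α → ℝ} (hf : Measurable f) (hh : Measurable h) :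
      Measurable fun a => g (f a) (h a) := hg.comp (hf.prodMk hh)
  have hp (r θ : ℝ) : 2 * r / √3 * sin (θ + π / 3) =
      r * cos θ + r * sin θ / √3 := by
    rw [sin_add, sin_pi_div_three, cos_pi_div_three]
    field_simp
    ring
  have hq (r θ : ℝ) : 2 * r / √3 * sin θ = 2 / √3 * (r * sin θ) := by ring
  calc
    _ = ∫⁻ q, ∫⁻ p, g p q := lintegral_lintegral_swap hg.aemeasurable
    _ = ENNReal.ofReal (2 / √3) * ∫⁻ y, ∫⁻ p, g p (2 / √3 * y) := by
      refine lintegral_eq_scale (by positivity) ?_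
      exact Measurable.lintegral_prod_right' (f := fun z : ℝ × ℝ => g z.2 z.1)
        (hm (by fun_prop) (by fun_prop))
    _ = ENNReal.ofReal (2 / √3) * ∫⁻ y, ∫⁻ x, g (x + y / √3) (2 / √3 * y) := by
      congr 1
      refine lintegral_congr fun y => ?_
      exact (lintegral_add_right_eq_self (fun p => g p (2 / √3 * y)) (y / √3)).symm
    _ = ENNReal.ofReal (2 / √3) * ∫⁻ x, ∫⁻ y, g (x + y / √3) (2 / √3 * y) := by
      rw [lintegral_lintegral_swap]
      exact (hm (by fun_prop) (by fun_prop)).aemeasurable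
    _ = ENNReal.ofReal (2 / √3) * ∫⁻ z : ℝ × ℝ, g (z.1 + z.2 / √3) (2 / √3 * z.2) := by
      rw [Measure.volume_eq_prod, lintegral_prod _ (hm (by fun_prop) (by fun_prop)).aemeasurable]
    _ = _ := by
      rw [← lintegral_comp_polarCoord_symm, polarCoord_target, Measure.volume_eq_prod,
        ← Measure.prod_restrict, lintegral_prod, ← lintegral_const_mul]
      · refine setLIntegral_congr_fun measurableSet_Ioi fun r hr => ?_
        have hr' : (0 : ℝ) < r := hr
        simp only [smul_eq_mul, polarCoord_symm_apply, hp, hq]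
        rw [lintegral_const_mul _ (hm (by fun_prop) (by fun_prop)), ← mul_assoc,
          ← ENNReal.ofReal_mul (by positivity), mul_comm (2 / √3)]
      · refine Measurable.lintegral_prod_right' (f := fun z : ℝ × ℝ => ENNReal.ofReal z.1 •
          g ((polarCoord.symm z).1 + (polarCoord.symm z).2 / √3) (2 / √3 * (polarCoord.symm z).2)) ?_
        simp only [smul_eq_mul, polarCoord_symm_apply]
        exact Measurable.mul (by fun_prop) (hm (by fun_prop) (by fun_prop))
      · simp only [smul_eq_mul, polarCoord_symm_apply]
        exact (Measurable.mul (by fun_prop) (hm (by fun_prop) (by fun_prop))).aemeasurable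

theorem lintegral_triangle_mul_dist {φ : ℝ → ℝ≥0∞} (hφ : Measurable φ) :
    ∫⁻ x, ∫⁻ y, ENNReal.ofReal (triangle x) * (ENNReal.ofReal (triangle y) *
        φ √((2 + x) ^ 2 + (1 + y) ^ 2 - (2 + x) * (1 + y))) =
      ∫⁻ d, φ d * ENNReal.ofReal (densityDE d) := by
  have ht := measurable_triangle
  let g (p q : ℝ) : ℝ≥0∞ := ENNReal.ofReal (triangle (p - 2)) *
    (ENNReal.ofReal (triangle (q - 1)) * φ √(p ^ 2 + q ^ 2 - p * q))
  have hg : Measurable (Function.uncurry g) := by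
    unfold Function.uncurry
    exact (ht.comp (by fun_prop)).mul ((ht.comp (by fun_prop)).mul (hφ.comp (by fun_prop)))
  calc
    _ = ∫⁻ p, ∫⁻ q, g p q := by
      rw [← lintegral_add_left_eq_self (fun p => ∫⁻ q, g p q) 2]
      refine lintegral_congr fun x => ?_
      rw [← lintegral_add_left_eq_self (fun q => g (2 + x) q) 1]
      simp only [g, add_sub_cancel_left]
    _ = ∫⁻ d in Set.Ioi (0 : ℝ), φ d * ENNReal.ofReal (densityDE d) := by
      rw [lintegral_oblique_polar hg]
      refine setLIntegral_congr_fun measurableSet_Ioi fun r hr => ?_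
      have hr' : (0 : ℝ) < r := hr
      rw [densityDE_eq_of_nonneg hr'.le, ENNReal.ofReal_mul (p := r * (2 / √3)) (by positivity),
        mul_left_comm]
      congr 1
      have hcont : Continuous fun θ => triangle (2 * r / √3 * sin (θ + π / 3) - 2) *
          triangle (2 * r / √3 * sin θ - 1) := by
        have := continuous_triangle
        fun_prop
      rw [triangleInt, intervalIntegral.integral_of_le (by linarith [pi_pos]),
        integral_Ioc_eq_integral_Ioo, ofReal_integral_eq_lintegral_ofReal,
        ← lintegral_const_mul _ hcont.measurable.ennreal_ofReal]
      · refine lintegral_congr fun θ => ?_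
        simp only [g]
        -- The distance equals `r` all along the circle, so `φ` factors out of the angular integral.
        rw [ENNReal.ofReal_mul (triangle_nonneg _),
          show (2 * r / √3 * sin (θ + π / 3)) ^ 2 + (2 * r / √3 * sin θ) ^ 2 -
            2 * r / √3 * sin (θ + π / 3) * (2 * r / √3 * sin θ) = r ^ 2 by
          linear_combination (2 * r / √3) ^ 2 * sin_add_pi_div_three_quadratic θ +
            3 / 4 * sq_two_mul_div_sqrt_three (d := r), sqrt_sq hr'.le]
        ring
      · exact (hcont.integrableOn_Icc (a := -π) (b := π)).mono_set Set.Ioo_subset_Icc_self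
      · exact Filter.Eventually.of_forall fun θ => mul_nonneg (triangle_nonneg _) (triangle_nonneg _)
    _ = _ := by
      refine setLIntegral_eq_of_support_subset fun d hd => ?_
      by_contra hc
      refine hd ?_
      have : d ∉ Set.Icc (√3 / 2) 3 := fun h => hc (lt_of_lt_of_le (by positivity) h.1)
      simp [densityDE_eq_zero_of_notMem this]

/-! ### The two rhombuses and the law of the distance -/

section config

variable {c u v : EuclideanSpace ℝ (Fin 2)}

theorem norm_smul_add_smul_sub (hu : ‖u‖ = 1) (hv : ‖v‖ = 1) (huv : inner ℝ u v = 1 / 2)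
    (p q : ℝ) : ‖p • u + q • (v - u)‖ = √(p ^ 2 + q ^ 2 - p * q) := by
  rw [← sqrt_sq (norm_nonneg _)]
  congr 1
  have h1 : inner ℝ u u = (1 : ℝ) := by rw [real_inner_self_eq_norm_sq, hu, one_pow]
  have h2 : inner ℝ v v = (1 : ℝ) := by rw [real_inner_self_eq_norm_sq, hv, one_pow]
  have h3 : inner ℝ v u = (1 / 2 : ℝ) := by rw [real_inner_comm, huv]
  rw [← real_inner_self_eq_norm_sq]
  simp only [inner_add_left, inner_add_right, inner_sub_left, inner_sub_right, real_inner_smul_left,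
    real_inner_smul_right, h1, h2, h3, huv]
  ring

theorem smul_add_smul_sub_eq_zero (hu : ‖u‖ = 1) (hv : ‖v‖ = 1) (huv : inner ℝ u v = 1 / 2)
    (p q : ℝ) (h : p • u + q • (v - u) = 0) : p = 0 ∧ q = 0 := by
  have e := norm_smul_add_smul_sub hu hv huv p q
  rw [h, norm_zero, eq_comm, sqrt_eq_zero'] at e
  constructor <;> nlinarith [sq_nonneg (p - q), sq_nonneg p, sq_nonneg q, sq_nonneg (p + q)]

theorem dist_parallelogramMap (hu : ‖u‖ = 1) (hv : ‖v‖ = 1) (huv : inner ℝ u v = 1 / 2)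
    (x y : ℝ × ℝ) :
    dist (parallelogramMap c u (v - u) x) (parallelogramMap (c + (u + v)) u (v - u) y) =
      √((2 + (y.1 - x.1)) ^ 2 + (1 + (y.2 - x.2)) ^ 2 - (2 + (y.1 - x.1)) * (1 + (y.2 - x.2))) := by
  rw [dist_comm, dist_eq_norm, ← norm_smul_add_smul_sub hu hv huv]
  congr 1
  simp only [parallelogramMap]
  module

end config

theorem map_dist_eq_withDensity {Ω : Type*} [MeasurableSpace Ω] {P : Measure Ω}
    [IsProbabilityMeasure P] {c u v : EuclideanSpace ℝ (Fin 2)} (hu : ‖u‖ = 1) (hv : ‖v‖ = 1)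
    (huv : inner ℝ u v = 1 / 2) {X Y : Ω → EuclideanSpace ℝ (Fin 2)} (hXm : AEMeasurable X P)
    (hYm : AEMeasurable Y P) (hX : P.map X = (unitMeasure.prod unitMeasure).map
      (parallelogramMap c u (v - u)))
    (hY : P.map Y = (unitMeasure.prod unitMeasure).map
      (parallelogramMap (c + (u + v)) u (v - u)))
    (hXY : IndepFun X Y P) :
    P.map (fun ω => dist (X ω) (Y ω)) =
      volume.withDensity fun d => ENNReal.ofReal (densityDE d) := by
  have hjoint := (indepFun_iff_map_prod_eq_prod_map_map hXm hYm).1 hXY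
  have m1 := (continuous_parallelogramMap c u (v - u)).measurable
  have m2 := (continuous_parallelogramMap (c + (u + v)) u (v - u)).measurable
  rw [hX, hY, Measure.map_prod_map _ _ m1 m2] at hjoint
  have hdist : P.map (fun ω => dist (X ω) (Y ω)) =
      (P.map fun ω => (X ω, Y ω)).map fun z => dist z.1 z.2 := by
    rw [AEMeasurable.map_map_of_aemeasurable (by fun_prop) (hXm.prodMk hYm)]
    rfl
  rw [hdist, hjoint, Measure.map_map (by fun_prop) (m1.prodMap m2)]
  refine Measure.ext_of_lintegral _ fun φ hφ => ?_
  have hd := measurable_densityDE.ennreal_ofReal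
  rw [lintegral_map hφ ((by fun_prop : Measurable fun z : EuclideanSpace ℝ (Fin 2) ×
    EuclideanSpace ℝ (Fin 2) => dist z.1 z.2).comp (m1.prodMap m2)),
    lintegral_withDensity_eq_lintegral_mul _ hd hφ, mul_comm]
  refine Eq.trans ?_ (lintegral_triangle_mul_dist hφ)
  rw [← lintegral_unitSquare_sub
    (φ := fun x y => φ √((2 + x) ^ 2 + (1 + y) ^ 2 - (2 + x) * (1 + y)))]
  · refine lintegral_congr fun z => ?_
    simp only [Function.comp, Prod.map, dist_parallelogramMap hu hv huv]
  · unfold Function.uncurry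
    exact hφ.comp (by fun_prop)

end

theorem mainTheorem4 {Ω : Type*} [MeasurableSpace Ω] (P : Measure Ω) [IsProbabilityMeasure P]
    (c u v : EuclideanSpace ℝ (Fin 2)) (hu : ‖u‖ = 1) (hv : ‖v‖ = 1) (huv : inner ℝ u v = 1 / 2)
    (X Y : Ω → EuclideanSpace ℝ (Fin 2))
    (hX : pdf.IsUniform X (rhombusD c u v) P volume)
    (hY : pdf.IsUniform Y (rhombusE c u v) P volume)
    (hXY : IndepFun X Y P) :
    (∀ d, 0 ≤ densityDE d) ∧
    Function.support densityDE ⊆ Set.Icc (√3 / 2) 3 ∧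
    HasPDF (fun ω => dist (X ω) (Y ω)) P volume ∧
    pdf (fun ω => dist (X ω) (Y ω)) P volume =ᵐ[volume] fun d => ENNReal.ofReal (densityDE d) := by
  have hlin := smul_add_smul_sub_eq_zero hu hv huv
  have hX' := hX.trans (cond_parallelogram_eq_map hlin)
  have hY' := hY.trans (cond_parallelogram_eq_map hlin)
  -- Uniformity only prescribes the law. The pushforward along a map that is not a.e. measurable is
  -- zero by convention, so a nonzero law already gives measurability.
  have hae {f : ℝ × ℝ → EuclideanSpace ℝ (Fin 2)} (hf : Continuous f)
      {Z : Ω → EuclideanSpace ℝ (Fin 2)} (hZ : P.map Z = (unitMeasure.prod unitMeasure).map f) :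
      AEMeasurable Z P := by
    have := Measure.isProbabilityMeasure_map (μ := unitMeasure.prod unitMeasure)
      hf.measurable.aemeasurable
    refine AEMeasurable.of_map_ne_zero ?_
    rw [hZ]
    exact IsProbabilityMeasure.ne_zero _
  have hXm := hae (continuous_parallelogramMap _ _ _) hX'
  have hYm := hae (continuous_parallelogramMap _ _ _) hY'
  have hmap := map_dist_eq_withDensity hu hv huv hXm hYm hX' hY' hXY
  have hd := measurable_densityDE.ennreal_ofReal.aemeasurable (μ := volume)
  have hpdf : HasPDF (fun ω => dist (X ω) (Y ω)) P volume :=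
    hasPDF_of_map_eq_withDensity (hXm.dist hYm) _ hd hmap
  refine ⟨densityDE_nonneg, fun d h => ?_, hpdf, (pdf.eq_of_map_eq_withDensity _ hd).1 hmap⟩
  by_contra hc
  exact h (densityDE_eq_zero_of_notMem hc)
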